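/- Let $K$ be a field with a non-trivial non-archimedean absolute value $|\cdot|$ for which it is complete, and put $B_K=\{\lambda\in K:|\lambda|\le 1\}$. Let $E$ be a metrizable locally convex space over $K$, i.e. a topological $K$-vector space whose topology is metrizable and is defined by a family of non-archimedean seminorms (seminorms $p$ with $p(x+y)\le\max(p(x),p(y))$). A subset of $E$ is called absolutely convex if it is a $B_K$-submodule of $E$, and convex if it is a translate $x+B$ of an absolutely convex set $B$. A function $\phi:E\to\mathbb{R}$ is called convex if $$\phi\Big(\sum_{i=1}^n\lambda_i x_i\Big)\le\max_{1\le i\le n}|\lambda_i|\,\phi(x_i)$$ for all $n\ge 1$, $x_1,\dots,x_n\in E$ and $\lambda_1,\dots,\lambda_n\in B_K$ with $\sum_{i=1}^n\lambda_i=1$. Let $A\subseteq E$ be absolutely convex. Then the following are equivalent: 1. $A$ is cf-compact: every continuous convex function $\phi:E\to\mathbb{R}$, restricted to $A$, has a minimum. 2. $A$ is c-compact: every family $\mathcal{C}$ of convex subsets of $A$ that are closed in $A$ and that has the finite intersection property satisfies $\bigcap\mathcal{C}\neq\emptyset$. -/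

import Mathlib

/-- The topology of `E` is defined by a (nonempty) family of seminorms satisfying the strong
triangle inequality `p (x + y) ≤ max (p x) (p y)`; this is what "locally convex" means over a
non-archimedean valued field. -/
def NonarchLocallyConvex (K E : Type*) [NontriviallyNormedField K] [AddCommGroup E] [Module K E]
    [TopologicalSpace E] : Prop :=
  ∃ P : Set (Seminorm K E), P.Nonempty ∧ (∀ p ∈ P, IsNonarchimedean p) ∧
    WithSeminorms (fun p : P => (p : Seminorm K E))

/-- `A` is a module over the closed unit ball `{c : K | ‖c‖ ≤ 1}`. -/
structure NonarchAbsConvex (K : Type*) {E : Type*} [NontriviallyNormedField K] [AddCommGroup E]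
    [Module K E] (A : Set E) : Prop where
  zero_mem : (0 : E) ∈ A
  add_mem : ∀ x ∈ A, ∀ y ∈ A, x + y ∈ A
  smul_mem : ∀ c : K, ‖c‖ ≤ 1 → ∀ x ∈ A, c • x ∈ A

/-- A convex set is a translate of an absolutely convex set. -/
def NonarchConvex (K : Type*) {E : Type*} [NontriviallyNormedField K] [AddCommGroup E]
    [Module K E] (C : Set E) : Prop :=
  ∃ (x : E) (B : Set E), NonarchAbsConvex K B ∧ C = (fun b => x + b) '' B

/-- c-compactness: a family of convex subsets of `A`, closed in the subspace topology of `A`, with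
the finite intersection property has a common point (intersections are taken inside `A`). -/
def CCompact (K : Type*) {E : Type*} [NontriviallyNormedField K] [AddCommGroup E] [Module K E]
    [TopologicalSpace E] (A : Set E) : Prop :=
  ∀ 𝒞 : Set (Set E),
    (∀ C ∈ 𝒞, C ⊆ A ∧ NonarchConvex K C ∧ ∃ F : Set E, IsClosed F ∧ C = F ∩ A) →
    (∀ 𝒟 : Set (Set E), 𝒟 ⊆ 𝒞 → 𝒟.Finite → (A ∩ ⋂₀ 𝒟).Nonempty) →
    (A ∩ ⋂₀ 𝒞).Nonempty

/-- Convex functions: `φ (∑ cᵢ xᵢ) ≤ maxᵢ ‖cᵢ‖ φ (xᵢ)` for all nonempty finite families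
with `‖cᵢ‖ ≤ 1` and `∑ cᵢ = 1`. -/
def NonarchConvexFun (K : Type*) {E : Type*} [NontriviallyNormedField K] [AddCommGroup E]
    [Module K E] (φ : E → ℝ) : Prop :=
  ∀ (n : ℕ) (x : Fin (n + 1) → E) (c : Fin (n + 1) → K),
    (∀ i, ‖c i‖ ≤ 1) → ∑ i, c i = 1 →
    φ (∑ i, c i • x i) ≤
      Finset.univ.sup' Finset.univ_nonempty (fun i : Fin (n + 1) => ‖c i‖ * φ (x i))

/-- cf-compactness: every continuous convex function on `E` attains a minimum on `A`. -/
def CfCompact (K : Type*) {E : Type*} [NontriviallyNormedField K] [AddCommGroup E] [Module K E]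
    [TopologicalSpace E] (A : Set E) : Prop :=
  ∀ φ : E → ℝ, Continuous φ → NonarchConvexFun K φ → ∃ a ∈ A, ∀ b ∈ A, φ a ≤ φ b

/-! From c-compact to cf-compact: the sublevel sets of `φ` through points of `A` are convex, closed
in `A` and form a chain, so they have a common point, which is a minimizer.

Conversely, cf-compactness first handles decreasing sequences of closed cosets `x n + N n`.
Thickening them by basic neighbourhoods gives decreasing clopen cosets `V n`. The function `∑ 2⁻ⁿ
1_{E ∖ V n} - 2` is continuous and convex; a minimizer on `A` lies in every `V n`, hence, by
closedness, in every original coset (`seqCCompact_of_cfCompact`).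

Passing from sequences to arbitrary families is the algebraic core. Extend the family to a maximal
filter of closed cosets. If it contains a coset of every `U n ⊓ A`, a point common to these is
adherent to each member of the family, so lies in it. Otherwise fix a bad `n`, a coset of some `N`
in the filter, and `x ∈ N` outside `U n ⊓ A`. A submodule `N'` maximal with `N' ∩ B_K x ⊆ U n ⊓ A`
has uniform quotient `N / N'`. Sequential c-compactness makes that quotient uniserial, and the
filter then descends to a coset of `N'`. Iteration yields elements independent modulo `U n ⊓ A`;
their partial sums define decreasing closed cosets with empty intersection, a contradiction. -/

/-- The closed unit ball of `K`, as a subring. -/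
def unitBallSubring (K : Type*) [NontriviallyNormedField K] [IsUltrametricDist K] : Subring K where
  carrier := {c | ‖c‖ ≤ 1}
  mul_mem' {a b} ha hb := by
    simpa using mul_le_one₀ (show ‖a‖ ≤ 1 from ha) (norm_nonneg b) hb
  one_mem' := by simp
  add_mem' {a b} ha hb := (IsUltrametricDist.norm_add_le_max a b).trans (max_le ha hb)
  zero_mem' := by simp
  neg_mem' {a} ha := by simpa using ha

/-! ### Divisibility in the unit ball. -/

namespace NonarchCompact

variable {K : Type*} [NontriviallyNormedField K] [IsUltrametricDist K]

theorem exists_eq_mul_of_norm_le {c d : unitBallSubring K} (h : ‖(c : K)‖ ≤ ‖(d : K)‖) :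
    ∃ e : unitBallSubring K, c = e * d := by
  by_cases hd : (d : K) = 0
  · refine ⟨0, Subtype.ext ?_⟩
    rw [hd, norm_zero] at h
    simpa using norm_le_zero_iff.1 h
  · refine ⟨⟨c / d, ?_⟩, Subtype.ext ?_⟩
    · change ‖(c / d : K)‖ ≤ 1
      rw [norm_div]
      exact div_le_one_of_le₀ h (norm_nonneg _)
    · simp [hd]

/-- A nonempty set of scalars contains a sequence that is cofinal with respect to the norm. -/
theorem exists_cofinal_seq (p : unitBallSubring K → Prop) (hp : ∃ c, p c) :
    ∃ c : ℕ → unitBallSubring K, (∀ k, p (c k)) ∧ (Monotone fun k => ‖(c k : K)‖) ∧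
      ∀ d, p d → ∃ k, ‖(d : K)‖ ≤ ‖(c k : K)‖ := by
  set S : Set ℝ := (fun c : unitBallSubring K => ‖(c : K)‖) '' {c | p c} with hS
  have hne : S.Nonempty := hp.elim fun c hc => ⟨_, c, hc, rfl⟩
  have hb : BddAbove S := ⟨1, by rintro _ ⟨c, -, rfl⟩; exact c.2⟩
  by_cases hm : sSup S ∈ S
  · obtain ⟨c, hc, hcS⟩ := hm
    exact ⟨fun _ => c, fun _ => hc, fun _ _ _ => le_rfl,
      fun d hd => ⟨0, (le_csSup hb ⟨d, hd, rfl⟩).trans_eq hcS.symm⟩⟩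
  · obtain ⟨u, hu, hlim, hmem⟩ := exists_seq_tendsto_sSup hne hb
    choose c hc hcu using hmem
    have hcu' : (fun k => ‖(c k : K)‖) = u := funext hcu
    refine ⟨c, hc, hcu' ▸ hu, fun d hd => ?_⟩
    have hlt : ‖(d : K)‖ < sSup S :=
      lt_of_le_of_ne (le_csSup hb ⟨d, hd, rfl⟩) fun h => hm (h ▸ ⟨d, hd, rfl⟩)
    obtain ⟨k, hk⟩ := (hlim.eventually (lt_mem_nhds hlt)).exists
    exact ⟨k, hk.le.trans_eq (hcu k).symm⟩

/-- A nonempty set of scalars contains a sequence that is coinitial with respect to the norm. -/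
theorem exists_coinitial_seq (p : unitBallSubring K → Prop) (hp : ∃ c, p c) :
    ∃ c : ℕ → unitBallSubring K, (∀ k, p (c k)) ∧ ∀ d, p d → ∃ k, ‖(c k : K)‖ ≤ ‖(d : K)‖ := by
  set S : Set ℝ := (fun c : unitBallSubring K => ‖(c : K)‖) '' {c | p c} with hS
  have hne : S.Nonempty := hp.elim fun c hc => ⟨_, c, hc, rfl⟩
  have hb : BddBelow S := ⟨0, by rintro _ ⟨c, -, rfl⟩; exact norm_nonneg _⟩
  by_cases hm : sInf S ∈ S
  · obtain ⟨c, hc, hcS⟩ := hm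
    exact ⟨fun _ => c, fun _ => hc, fun d hd => ⟨0, hcS.trans_le (csInf_le hb ⟨d, hd, rfl⟩)⟩⟩
  · obtain ⟨u, -, hlim, hmem⟩ := exists_seq_tendsto_sInf hne hb
    choose c hc hcu using hmem
    refine ⟨c, hc, fun d hd => ?_⟩
    have hlt : sInf S < ‖(d : K)‖ :=
      lt_of_le_of_ne (csInf_le hb ⟨d, hd, rfl⟩) fun h => hm (h ▸ ⟨d, hd, rfl⟩)
    obtain ⟨k, hk⟩ := (hlim.eventually (gt_mem_nhds hlt)).exists
    exact ⟨k, (hcu k).trans_le hk.le⟩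

/-! ### Closed cosets. -/

variable {E : Type*} [AddCommGroup E] [Module K E]

/-- The coset `x + N`. -/
def coset (x : E) (N : Submodule (unitBallSubring K) E) : Set E := {y | y - x ∈ N}

theorem mem_coset {x y : E} {N : Submodule (unitBallSubring K) E} : y ∈ coset x N ↔ y - x ∈ N :=
    Iff.rfl

theorem self_mem_coset (x : E) (N : Submodule (unitBallSubring K) E) : x ∈ coset x N :=
    by simp [mem_coset]

theorem coset_eq_of_mem {x y : E} {N : Submodule (unitBallSubring K) E} (h : y ∈ coset x N) :
    coset x N = coset y N := by
  ext z
  rw [mem_coset] at h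
  rw [mem_coset, mem_coset]
  constructor <;> intro hz
  · simpa using N.sub_mem hz h
  · simpa using N.add_mem hz h

/-- `N` is a submodule of `A`, closed in `A` for the linear topology with basis `U`. -/
structure RelClosed (A : Submodule (unitBallSubring K) E) (U : ℕ → Submodule (unitBallSubring K) E)
    (N : Submodule (unitBallSubring K) E) : Prop where
  le : N ≤ A
  mem : ∀ a ∈ A, (∀ n, ∃ y ∈ N, a - y ∈ U n) → a ∈ N

/-- Cosets in `A` of relatively closed submodules. -/
def ClosedCoset (A : Submodule (unitBallSubring K) E) (U : ℕ → Submodule (unitBallSubring K) E)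
    (C : Set E) : Prop :=
  ∃ x ∈ A, ∃ N, RelClosed A U N ∧ C = coset x N

/-- Decreasing sequences of closed cosets in `A` have nonempty intersection. -/
def SeqCCompact (A : Submodule (unitBallSubring K) E) (U : ℕ →
    Submodule (unitBallSubring K) E) : Prop :=
  ∀ (x : ℕ → E) (N : ℕ → Submodule (unitBallSubring K) E), (∀ n, x n ∈ A) →
    (∀ n, RelClosed A U (N n)) →
    Antitone N → (∀ n, x (n + 1) - x n ∈ N n) → ∃ a ∈ A, ∀ n, a - x n ∈ N n

variable {A : Submodule (unitBallSubring K) E} {U : ℕ → Submodule (unitBallSubring K) E}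

/-- Open submodules are closed, so above `U n ⊓ A` the arguments become purely algebraic. -/
theorem RelClosed.of_open {N : Submodule (unitBallSubring K) E} (n : ℕ) (hU : U n ⊓ A ≤ N)
    (hN : N ≤ A) :
    RelClosed A U N := by
  refine ⟨hN, fun a ha h => ?_⟩
  obtain ⟨y, hy, hay⟩ := h n
  simpa using N.add_mem (hU ⟨hay, A.sub_mem ha (hN hy)⟩) hy

theorem RelClosed.inf {N L : Submodule (unitBallSubring K) E} (hN : RelClosed A U N)
    (hL : RelClosed A U L) :
    RelClosed A U (N ⊓ L) := by
  refine ⟨inf_le_left.trans hN.le, fun a ha h => ⟨hN.mem a ha fun n => ?_, hL.mem a ha fun n => ?_⟩⟩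
  · exact (h n).imp fun y hy => ⟨hy.1.1, hy.2⟩
  · exact (h n).imp fun y hy => ⟨hy.1.2, hy.2⟩

theorem RelClosed.iInf {N : ℕ → Submodule (unitBallSubring K) E} (hN : ∀ k, RelClosed A U (N k)) :
    RelClosed A U (⨅ k, N k) := by
  refine ⟨(iInf_le N 0).trans (hN 0).le, fun a ha h => ?_⟩
  rw [Submodule.mem_iInf]
  exact fun k => (hN k).mem a ha fun n =>
    (h n).imp fun y hy => ⟨(Submodule.mem_iInf N).1 hy.1 k, hy.2⟩

theorem RelClosed.self : RelClosed A U A := ⟨le_rfl, fun _ ha _ => ha⟩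

theorem ClosedCoset.subset {C : Set E} (h : ClosedCoset A U C) : C ⊆ A := by
  obtain ⟨x, hx, N, hN, rfl⟩ := h
  intro y hy
  simpa using A.add_mem (hN.le hy) hx

theorem ClosedCoset.self : ClosedCoset A U (A : Set E) :=
  ⟨0, A.zero_mem, A, .self, by ext; simp [mem_coset]⟩

theorem ClosedCoset.inter {C D : Set E} (hC : ClosedCoset A U C) (hD : ClosedCoset A U D)
    (h : (C ∩ D).Nonempty) : ClosedCoset A U (C ∩ D) := by
  obtain ⟨z, hz⟩ := h
  have hzA := hC.subset hz.1
  obtain ⟨x, hx, N, hN, rfl⟩ := hC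
  obtain ⟨y, hy, L, hL, rfl⟩ := hD
  refine ⟨z, hzA, N ⊓ L, hN.inf hL, ?_⟩
  rw [coset_eq_of_mem hz.1, coset_eq_of_mem hz.2]
  rfl

theorem SeqCCompact.nonempty_iInter (H : SeqCCompact A U) {C : ℕ → Set E}
    (hC : ∀ n, ClosedCoset A U (C n)) (hanti : Antitone C) : (⋂ n, C n).Nonempty := by
  choose x hx N hN hCN using hC
  have hx1 : ∀ n, x (n + 1) - x n ∈ N n := fun n => by
    have : x (n + 1) ∈ C n := hanti n.le_succ (by rw [hCN]; exact self_mem_coset _ _)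
    rwa [hCN n] at this
  obtain ⟨a, -, ha⟩ := H x N hx hN (antitone_nat_of_succ_le fun n z hz => by
    have : x (n + 1) + z ∈ C n := hanti n.le_succ (by rw [hCN]; simpa [mem_coset] using hz)
    rw [hCN n, mem_coset] at this
    have h2 := (N n).sub_mem this (hx1 n)
    rwa [show x (n + 1) + z - x n - (x (n + 1) - x n) = z by abel] at h2) hx1
  exact ⟨a, Set.mem_iInter.2 fun n => by rw [hCN]; exact ha n⟩

/-! ### Maximal filters of closed cosets. -/

/-- A family of closed cosets containing `A` and closed under pairwise intersection. -/
structure CosetFilter (A : Submodule (unitBallSubring K) E) (U : ℕ →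
    Submodule (unitBallSubring K) E) (F : Set (Set E)) : Prop where
  coset : ∀ C ∈ F, ClosedCoset A U C
  self_mem : (A : Set E) ∈ F
  inter_mem : ∀ C ∈ F, ∀ D ∈ F, C ∩ D ∈ F

theorem CosetFilter.exists_maximal {F : Set (Set E)} (hF : CosetFilter A U F) :
    ∃ G, F ⊆ G ∧ Maximal (CosetFilter A U) G := by
  refine zorn_subset_nonempty {G | CosetFilter A U G} (fun c hc hchain hne => ?_) F hF
  refine ⟨⋃₀ c, ⟨?_, ?_, ?_⟩, fun s hs => Set.subset_sUnion_of_mem hs⟩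
  · rintro C ⟨G, hG, hCG⟩
    exact (hc hG).coset C hCG
  · obtain ⟨G, hG⟩ := hne
    exact ⟨G, hG, (hc hG).self_mem⟩
  · rintro C ⟨G, hG, hCG⟩ D ⟨G', hG', hDG'⟩
    rcases hchain.total hG hG' with h | h
    · exact ⟨G', hG', (hc hG').inter_mem _ (h hCG) _ hDG'⟩
    · exact ⟨G, hG, (hc hG).inter_mem _ hCG _ (h hDG')⟩

variable {F : Set (Set E)}

/-- The traces of `D` on members of `F` can be adjoined to `F`; maximality does the rest. -/
theorem mem_of_forall_meets (hF : Maximal (CosetFilter A U) F) {D : Set E}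
    (hD : ClosedCoset A U D) (hmeet : ∀ C ∈ F, (C ∩ D).Nonempty) : D ∈ F := by
  have key : CosetFilter A U (F ∪ (fun C => C ∩ D) '' F) := by
    refine ⟨?_, Or.inl hF.1.self_mem, ?_⟩
    · rintro C (hC | ⟨C, hC, rfl⟩)
      · exact hF.1.coset C hC
      · exact (hF.1.coset C hC).inter hD (hmeet C hC)
    · rintro C (hC | ⟨C, hC, rfl⟩) C' (hC' | ⟨C', hC', rfl⟩)
      · exact Or.inl (hF.1.inter_mem _ hC _ hC')
      · exact Or.inr ⟨_, hF.1.inter_mem _ hC _ hC', Set.inter_assoc _ _ _⟩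
      · exact Or.inr ⟨_, hF.1.inter_mem _ hC _ hC', Set.inter_right_comm _ _ _⟩
      · exact Or.inr ⟨_, hF.1.inter_mem _ hC _ hC', Set.inter_inter_distrib_right _ _ _⟩
  exact hF.2 key Set.subset_union_left
    (Or.inr ⟨A, hF.1.self_mem, Set.inter_eq_right.2 hD.subset⟩)

theorem CosetFilter.nonempty (hF : CosetFilter A U F) {C : Set E} (hC : C ∈ F) : C.Nonempty := by
  obtain ⟨x, -, N, -, rfl⟩ := hF.coset C hC
  exact ⟨x, self_mem_coset _ _⟩

theorem mem_of_superset (hF : Maximal (CosetFilter A U) F) {C D : Set E} (hC : C ∈ F)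
    (hD : ClosedCoset A U D) (h : C ⊆ D) : D ∈ F :=
  mem_of_forall_meets hF hD fun _ hC' =>
    (hF.1.nonempty (hF.1.inter_mem _ hC' _ hC)).mono (Set.inter_subset_inter_right _ h)

theorem coset_iInf_mem (H : SeqCCompact A U) (hF : Maximal (CosetFilter A U) F) {x : ℕ → E}
    {N : ℕ → Submodule (unitBallSubring K) E} (hN : ∀ k, RelClosed A U (N k))
      (hx : ∀ k, coset (x k) (N k) ∈ F) :
    ∃ a, (∀ k, a ∈ coset (x k) (N k)) ∧ coset a (⨅ k, N k) ∈ F := by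
  -- The finite intersections with `D` stay in `F` and decrease, so sequential c-compactness
  -- applies.
  have key : ∀ D ∈ F, (D ∩ ⋂ k, coset (x k) (N k)).Nonempty := by
    intro D hD
    have hmem : ∀ n, (D ∩ ⋂ k ≤ n, coset (x k) (N k)) ∈ F := by
      intro n
      induction n with
      | zero => simpa using hF.1.inter_mem _ hD _ (hx 0)
      | succ n ih =>
        have := hF.1.inter_mem _ ih _ (hx (n + 1))
        rwa [Set.inter_assoc, ← Set.biInter_le_succ (fun k => coset (x k) (N k))] at this
    have := H.nonempty_iInter (fun n => hF.1.coset _ (hmem n)) (fun m n hmn =>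
      Set.inter_subset_inter_right _
        (Set.biInter_mono (fun k (hk : k ≤ m) => hk.trans hmn) fun _ _ => subset_rfl))
    refine this.mono fun z hz => ?_
    rw [Set.mem_iInter] at hz
    exact ⟨(hz 0).1, Set.mem_iInter.2 fun k => Set.mem_iInter₂.1 (hz k).2 k le_rfl⟩
  obtain ⟨a, haA, ha⟩ := key _ hF.1.self_mem
  rw [Set.mem_iInter] at ha
  have heq : coset a (⨅ k, N k) = ⋂ k, coset (x k) (N k) := by
    ext z
    simp only [mem_coset, Submodule.mem_iInf, Set.mem_iInter]
    exact forall_congr' fun k => by rw [← mem_coset, ← mem_coset, coset_eq_of_mem (ha k)]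
  exact ⟨a, ha, mem_of_forall_meets hF ⟨a, haA, _, .iInf hN, rfl⟩ (heq ▸ key)⟩

/-! ### Uniform and uniserial quotients. -/

/-- `N / N'` is uniserial: its cyclic submodules are totally ordered. -/
def UniserialQuot (N' N : Submodule (unitBallSubring K) E) : Prop :=
  ∀ x ∈ N, ∀ y ∈ N, (∃ c : unitBallSubring K, y - c • x ∈ N') ∨
    ∃ c : unitBallSubring K, x - c • y ∈ N'

/-- Any two nonzero elements of `N / N'` have a common nonzero multiple. -/
def UniformQuot (N' N : Submodule (unitBallSubring K) E) : Prop :=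
  ∀ x ∈ N, x ∉ N' → ∀ y ∈ N, y ∉ N' → ∃ c d : unitBallSubring K, c • x ∉ N' ∧ c • x - d • y ∈ N'

/-- Uniseriality gives a least submodule `L₀` above `N'` with a coset in `F`. Minimality makes every
member of `F` meet the coset `a + N'` inside `a + L₀`. -/
theorem exists_coset_mem_of_uniserial (H : SeqCCompact A U) (hF : Maximal (CosetFilter A U) F)
    {n : ℕ} {N N' : Submodule (unitBallSubring K) E} (hU : U n ⊓ A ≤ N') (hN'N : N' ≤ N)
      (hNA : N ≤ A)
    (huni : UniserialQuot N' N) {x₀ : E} (hx₀ : coset x₀ N ∈ F) : ∃ a, coset a N' ∈ F := by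
  have hcl : ∀ L, N' ≤ L → L ≤ N → RelClosed A U L := fun L h h' =>
    .of_open n (hU.trans h) (h'.trans hNA)
  set 𝓛 : Set (Submodule (unitBallSubring K) E) := {L | N' ≤ L ∧ L ≤ N ∧ ∃ a, coset a L ∈ F} with h𝓛
  obtain ⟨L₀, ⟨hL₀', hL₀N, a, ha⟩, hmin⟩ : ∃ L₀ ∈ 𝓛, ∀ L ∈ 𝓛, L₀ ≤ L := by
    by_cases htriv : ∀ L ∈ 𝓛, N ≤ L
    · exact ⟨N, ⟨hN'N, le_rfl, x₀, hx₀⟩, htriv⟩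
    push Not at htriv
    obtain ⟨L₁, ⟨hL₁', hL₁N, a₁, ha₁⟩, hne⟩ := htriv
    obtain ⟨x, hxN, hxL⟩ := SetLike.not_le_iff_exists.1 hne
    -- As `x ∉ L₁`, every element of `L₁` is a multiple of `x` modulo `N'`. Membership is thus
    -- governed by norms of scalars, and countably many submodules reach the infimum of `𝓛`.
    obtain ⟨c, hc, hcofin⟩ := exists_coinitial_seq (K := K) (fun c => ∃ L ∈ 𝓛, c • x ∉ L)
      ⟨1, L₁, ⟨hL₁', hL₁N, a₁, ha₁⟩, by simpa using hxL⟩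
    choose L hL hcL using hc
    choose hL' hLN b hb using hL
    have hseq := coset_iInf_mem H hF (x := fun k => k.casesOn a₁ b)
      (N := fun k => k.casesOn L₁ L) (fun k => by
        cases k with
        | zero => exact hcl _ hL₁' hL₁N
        | succ k => exact hcl _ (hL' k) (hLN k)) (fun k => by
        cases k with
        | zero => exact ha₁
        | succ k => exact hb k)
    obtain ⟨a, -, ha⟩ := hseq
    refine ⟨_, ⟨le_iInf fun k => ?_, (iInf_le _ 0).trans hL₁N, a, ha⟩, fun M hM y hy => ?_⟩
    · cases k with
      | zero => exact hL₁'
      | succ k => exact hL' k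
    · rw [Submodule.mem_iInf] at hy
      have hy1 : y ∈ L₁ := hy 0
      rcases huni x hxN y (hL₁N hy1) with ⟨d, hd⟩ | ⟨d, hd⟩
      · by_contra hyM
        have hdM : d • x ∉ M := fun h => hyM (by simpa using M.add_mem (hM.1 hd) h)
        obtain ⟨k, hk⟩ := hcofin d ⟨M, hM, hdM⟩
        obtain ⟨e, he⟩ := exists_eq_mul_of_norm_le hk
        refine hcL k ?_
        rw [he, mul_smul]
        refine (L k).smul_mem e ?_
        have := (L k).sub_mem (hy (k + 1)) (hL' k hd)
        simpa using this
      · exact (hxL (by simpa using L₁.add_mem (hL₁' hd) (L₁.smul_mem d hy1))).elim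
  have haA : a ∈ A := (hF.1.coset _ ha).subset (self_mem_coset _ _)
  refine ⟨a, mem_of_forall_meets hF ⟨a, haA, N', hcl _ le_rfl hN'N, rfl⟩ fun C hC => ?_⟩
  have hCC := hF.1.inter_mem _ hC _ ha
  obtain ⟨b, hb, hbL⟩ := hF.1.nonempty hCC
  have hbA := (hF.1.coset _ hC).subset hb
  obtain ⟨y, hy, B, hB, rfl⟩ := hF.1.coset _ hC
  rw [coset_eq_of_mem hb, coset_eq_of_mem hbL] at hCC
  -- The coset of `(L₀ ⊓ B) ⊔ N'` through `b` contains a member of `F`, so this submodule belongs to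
  -- `𝓛`.
  have hsub : L₀ ≤ (L₀ ⊓ B) ⊔ N' := by
    have h1 : (L₀ ⊓ B) ⊔ N' ≤ N := sup_le (inf_le_left.trans hL₀N) hN'N
    refine hmin _ ⟨le_sup_right, h1, b, mem_of_superset hF hCC
      ⟨b, hbA, _, hcl _ le_sup_right h1, rfl⟩ fun z hz => ?_⟩
    exact Submodule.mem_sup_left ⟨hz.2, hz.1⟩
  have hab : a - b ∈ L₀ := by simpa using L₀.neg_mem hbL
  obtain ⟨z, hz, n', hn', hsum⟩ := Submodule.mem_sup.1 (hsub hab)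
  refine ⟨b + z, ?_, ?_⟩
  · rw [coset_eq_of_mem hb, mem_coset]
    simpa using hz.2
  · have hb' : b + z - a = -n' := by
      rw [eq_add_of_sub_eq hsum.symm]
      abel
    rw [mem_coset, hb']
    exact N'.neg_mem hn'

/-- Every element `y` has a best approximation modulo `N'` by multiples of `x`. -/
theorem exists_best_approx (H : SeqCCompact A U) {n : ℕ} {N' : Submodule (unitBallSubring K) E}
    (hU : U n ⊓ A ≤ N') (hN'A : N' ≤ A) {x y : E} (hx : x ∈ A) :
    ∃ (ν : unitBallSubring K) (c : ℕ → unitBallSubring K), (∀ k, c k • (y - ν • x) ∈ N') ∧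
      ∀ d ν' : unitBallSubring K, d • (y - ν' • x) ∈ N' → ∃ k, ‖(d : K)‖ ≤ ‖(c k : K)‖ := by
  obtain ⟨c, hc, hmono, hcofin⟩ :=
    exists_cofinal_seq (K := K) (fun c => ∃ ν : unitBallSubring K, c • (y - ν • x) ∈ N')
      ⟨0, 0, by simp⟩
  choose ν hν using hc
  let S : Submodule (unitBallSubring K) E := Submodule.span (unitBallSubring K) {x} ⊔ N'
  have hSA : S ≤ A := sup_le (by simpa [Submodule.span_le] using hx) hN'A
  -- Intersecting with `S` forces the limit point to be a multiple of `x` modulo `N'`.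
  let N : ℕ → Submodule (unitBallSubring K) E := fun k =>
    S ⊓ N'.comap (LinearMap.lsmul (unitBallSubring K) E (c k))
  have hmemN : ∀ k z, z ∈ N k ↔ z ∈ S ∧ c k • z ∈ N' := fun k z => Iff.rfl
  have hxS : ∀ d : unitBallSubring K, d • x ∈ S := fun d =>
    Submodule.mem_sup_left (Submodule.smul_mem _ _ (Submodule.mem_span_singleton_self x))
  obtain ⟨a, -, ha⟩ := H (fun k => ν k • x) N (fun k => A.smul_mem _ hx)
    (fun k => .of_open n (fun z hz => ⟨Submodule.mem_sup_right (hU hz), N'.smul_mem _ (hU hz)⟩)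
      (inf_le_left.trans hSA))
    (fun i j hij z hz => by
      obtain ⟨e, he⟩ := exists_eq_mul_of_norm_le (hmono hij)
      refine ⟨hz.1, ?_⟩
      change c i • z ∈ N'
      rw [he, mul_smul]
      exact N'.smul_mem _ hz.2)
    (fun k => by
      refine (hmemN _ _).2 ⟨S.sub_mem (hxS _) (hxS _), ?_⟩
      obtain ⟨e, he⟩ := exists_eq_mul_of_norm_le (hmono k.le_succ)
      have h1 : c k • (y - ν (k + 1) • x) ∈ N' := by
        rw [he, mul_smul]
        exact N'.smul_mem _ (hν (k + 1))
      have h2 := N'.sub_mem (hν k) h1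
      rwa [← smul_sub, sub_sub_sub_cancel_left] at h2)
  have haS : a ∈ S := by simpa using S.add_mem (ha 0).1 (hxS (ν 0))
  obtain ⟨w, hw, m, hm, rfl⟩ := Submodule.mem_sup.1 haS
  obtain ⟨μ, rfl⟩ := Submodule.mem_span_singleton.1 hw
  refine ⟨μ, c, fun k => ?_, fun d ν' h => hcofin d ⟨ν', h⟩⟩
  have h1 : c k • (μ • x + m - ν k • x) ∈ N' := (ha k).2
  have h2 := N'.add_mem (N'.sub_mem (hν k) h1) (N'.smul_mem (c k) hm)
  rwa [← smul_sub, ← smul_add,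
    show y - ν k • x - (μ • x + m - ν k • x) + m = y - μ • x by abel] at h2

/-- In a uniform quotient, if `x` and `y` have the common nonzero multiple `lam • x = mu • y` with
`‖lam‖ ≤ ‖mu‖` then `y` is a multiple of `x`. -/
theorem exists_eq_smul_of_uniform (H : SeqCCompact A U) {n : ℕ}
    {N N' : Submodule (unitBallSubring K) E}
    (hU : U n ⊓ A ≤ N') (hN'N : N' ≤ N) (hNA : N ≤ A) (huni : UniformQuot N' N) {x y : E}
    (hx : x ∈ N) (hy : y ∈ N) {lam mu : unitBallSubring K} (hlm : ‖(lam : K)‖ ≤ ‖(mu : K)‖)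
      (hlx : lam • x ∉ N')
    (hxy : lam • x - mu • y ∈ N') : ∃ c : unitBallSubring K, y - c • x ∈ N' := by
  obtain ⟨ν, c, hc, hbest⟩ := exists_best_approx H hU (hN'N.trans hNA) (y := y) (hNA hx)
  refine ⟨ν, ?_⟩
  by_contra hne
  have hxN' : x ∉ N' := fun h => hlx (N'.smul_mem _ h)
  obtain ⟨c', d, hc'x, hcd⟩ := huni x hx hxN' _ (N.sub_mem hy (N.smul_mem ν hx)) hne
  have hdy : d • (y - ν • x) ∉ N' := fun h => hc'x (by simpa using N'.add_mem hcd h)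
  -- `d` does not annihilate the error `y - ν • x` modulo `N'`, whereas every `c k` does.
  have hlt : ∀ k, ‖(c k : K)‖ < ‖(d : K)‖ := fun k => by
    by_contra! hle
    obtain ⟨e, he⟩ := exists_eq_mul_of_norm_le hle
    exact hdy (by rw [he, mul_smul]; exact N'.smul_mem _ (hc k))
  rcases le_total ‖(c' : K)‖ ‖(d : K)‖ with hle | hle
  -- Here `ν + e` is a better approximation: its error is annihilated by `d`.
  · obtain ⟨e, he⟩ := exists_eq_mul_of_norm_le hle
    obtain ⟨k, hk⟩ := hbest d (ν + e) (by
      have := N'.neg_mem hcd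
      rwa [he, mul_comm, mul_smul, ← smul_sub, ← smul_neg, neg_sub, sub_sub, ← add_smul] at this)
    exact (hlt k).not_ge hk
  -- Here `x` is a multiple of the error, up to something killed by `c'`. As `mu` kills `y - ρ • x`,
  -- it is dominated by some `c k` and kills the error too, hence `x`.
  · obtain ⟨e, he⟩ := exists_eq_mul_of_norm_le hle
    obtain ⟨ρ, hρ⟩ := exists_eq_mul_of_norm_le hlm
    obtain ⟨k, hk⟩ := hbest mu ρ (by
      have := N'.neg_mem hxy
      rwa [hρ, mul_comm, mul_smul, ← smul_sub, ← smul_neg, neg_sub] at this)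
    obtain ⟨f, hf⟩ := exists_eq_mul_of_norm_le hk
    obtain ⟨g, hg⟩ := exists_eq_mul_of_norm_le ((hk.trans (hlt k).le).trans hle)
    have h1 : mu • (x - e • (y - ν • x)) ∈ N' := by
      rw [he, mul_comm, mul_smul, ← smul_sub] at hcd
      rw [hg, mul_smul]
      exact N'.smul_mem _ hcd
    have h2 : mu • e • (y - ν • x) ∈ N' := by
      rw [smul_comm, hf, mul_smul]
      exact N'.smul_mem _ (N'.smul_mem _ (hc k))
    have h3 : mu • x ∈ N' := by simpa [smul_sub] using N'.add_mem h1 h2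
    exact hlx (by rw [hρ, mul_smul]; exact N'.smul_mem _ h3)

theorem UniformQuot.uniserial (H : SeqCCompact A U) {n : ℕ} {N N' : Submodule (unitBallSubring K) E}
    (hU : U n ⊓ A ≤ N') (hN'N : N' ≤ N) (hNA : N ≤ A) (huni : UniformQuot N' N) :
    UniserialQuot N' N := by
  intro x hx y hy
  by_cases hxN : x ∈ N'
  · exact Or.inr ⟨0, by simpa using hxN⟩
  by_cases hyN : y ∈ N'
  · exact Or.inl ⟨0, by simpa using hyN⟩
  obtain ⟨c, d, hcx, hcd⟩ := huni x hx hxN y hy hyN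
  rcases le_total ‖(c : K)‖ ‖(d : K)‖ with h | h
  · exact Or.inl (exists_eq_smul_of_uniform H hU hN'N hNA huni hx hy h hcx hcd)
  · refine Or.inr (exists_eq_smul_of_uniform H hU hN'N hNA huni hy hx h (fun hdy => hcx ?_) ?_)
    · simpa using N'.add_mem hcd hdy
    · simpa using N'.neg_mem hcd

/-- A relative complement of a cyclic submodule is a submodule with uniform quotient. -/
theorem exists_uniform_quot {N V : Submodule (unitBallSubring K) E} (hVN : V ≤ N) (x : E) :
    ∃ N', V ≤ N' ∧ N' ≤ N ∧ (∀ c : unitBallSubring K, c • x ∈ N' → c • x ∈ V) ∧ UniformQuot N' N :=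
      by
  obtain ⟨N', hVN', hmax⟩ := zorn_le_nonempty₀
    {L : Submodule (unitBallSubring K) E | L ≤ N ∧ ∀ c : unitBallSubring K, c • x ∈ L → c • x ∈ V}
    (fun s hs hchain L hL => by
      refine ⟨sSup s, ⟨sSup_le fun M hM => (hs hM).1, fun c hc => ?_⟩, fun M hM => le_sSup hM⟩
      obtain ⟨M, hM, hcM⟩ := (Submodule.mem_sSup_of_directed ⟨L, hL⟩ hchain.directedOn).1 hc
      exact (hs hM).2 c hcM) V ⟨hVN, fun c hc => hc⟩
  refine ⟨N', hVN', hmax.1.1, hmax.1.2, ?_⟩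
  -- By maximality, adjoining `w` to `N'` must create a new multiple of `x`; multiples of `x` are
  -- comparable, which then gives uniformity.
  have hess : ∀ w ∈ N, w ∉ N' → ∃ c d : unitBallSubring K, c • x ∉ N' ∧ c • x - d • w ∈ N' := by
    intro w hw hwN'
    by_contra! hno
    refine hwN' (hmax.2 (y := N' ⊔ Submodule.span (unitBallSubring K) {w})
      ⟨sup_le hmax.1.1 (by simpa [Submodule.span_le] using hw), fun c hc => ?_⟩ le_sup_left
      (Submodule.mem_sup_right (Submodule.mem_span_singleton_self w)))
    obtain ⟨m, hm, z, hz, hsum⟩ := Submodule.mem_sup.1 hc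
    obtain ⟨d, rfl⟩ := Submodule.mem_span_singleton.1 hz
    by_contra hcV
    exact hno c d (fun h => hcV (hmax.1.2 c h)) (by rw [← hsum]; simpa using hm)
  intro w₁ hw₁ hw₁' w₂ hw₂ hw₂'
  obtain ⟨c₁, d₁, hc₁, h₁⟩ := hess w₁ hw₁ hw₁'
  obtain ⟨c₂, d₂, hc₂, h₂⟩ := hess w₂ hw₂ hw₂'
  rcases le_total ‖(c₁ : K)‖ ‖(c₂ : K)‖ with h | h
  · obtain ⟨e, rfl⟩ := exists_eq_mul_of_norm_le h
    refine ⟨d₁, e * d₂, fun hd => hc₁ (by simpa using N'.add_mem h₁ hd), ?_⟩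
    have := N'.sub_mem (N'.smul_mem e h₂) h₁
    rwa [smul_sub, ← mul_smul, ← mul_smul, sub_sub_sub_cancel_left] at this
  · obtain ⟨e, rfl⟩ := exists_eq_mul_of_norm_le h
    have h₁' : (e * c₁) • x - (e * d₁) • w₁ ∈ N' := by
      simpa only [smul_sub, ← mul_smul] using N'.smul_mem e h₁
    refine ⟨e * d₁, d₂, fun hd => hc₂ (by simpa using N'.add_mem h₁' hd), ?_⟩
    simpa using N'.sub_mem h₂ h₁'

/-! ### Independent sequences and descent to open cosets. -/

/-- There is no infinite sequence of independent cyclic submodules modulo an open submodule. -/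
theorem not_exists_independent_seq (H : SeqCCompact A U) (n : ℕ) (N : ℕ →
    Submodule (unitBallSubring K) E)
    (x : ℕ → E) (hN : Antitone N) (hNA : ∀ k, N k ≤ A) (hUN : ∀ k, U n ⊓ A ≤ N k)
    (hx : ∀ k, x k ∈ N k) (hxU : ∀ k, x k ∉ U n ⊓ A)
    (hind : ∀ k, ∀ c : unitBallSubring K, c • x k ∈ N (k + 1) → c • x k ∈ U n ⊓ A) : False := by
  set V₀ := U n ⊓ A with hV₀
  let V : ℕ → Submodule (unitBallSubring K) E := fun k => k.rec V₀ fun i W =>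
    W ⊔ Submodule.span (unitBallSubring K) {x i}
  have hVs : ∀ k, V (k + 1) = V k ⊔ Submodule.span (unitBallSubring K) {x k} := fun k => rfl
  have hVmono : Monotone V := monotone_nat_of_le_succ fun k => hVs k ▸ le_sup_left
  have hxV : ∀ k, x k ∈ V (k + 1) := fun k =>
    Submodule.mem_sup_right (Submodule.mem_span_singleton_self _)
  have hVN : ∀ k, ∀ v ∈ V k, v ∈ N k → v ∈ V₀ := by
    intro k
    induction k with
    | zero => exact fun v hv _ => hv
    | succ k ih =>
      intro v hv hvN
      rw [hVs] at hv
      obtain ⟨w, hw, z, hz, rfl⟩ := Submodule.mem_sup.1 hv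
      obtain ⟨c, rfl⟩ := Submodule.mem_span_singleton.1 hz
      have hwN : w ∈ N k := by
        simpa using (N k).sub_mem (hN k.le_succ hvN) ((N k).smul_mem c (hx k))
      have hwV := ih w hw hwN
      refine V₀.add_mem hwV (hind k c ?_)
      simpa using (N (k + 1)).sub_mem hvN (hUN (k + 1) hwV)
  let D : Submodule (unitBallSubring K) E := ⨆ k, V k
  have hVD : ∀ k, V k ≤ D := le_iSup V
  let s : ℕ → E := fun k => ∑ i ∈ Finset.range k, x i
  have hs : ∀ k, s k ∈ V k := fun k => Submodule.sum_mem _ fun i hi =>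
    hVmono (Finset.mem_range.1 hi) (hxV i)
  have hsA : ∀ k, s k ∈ A := fun k => Submodule.sum_mem _ fun i _ => hNA i (hx i)
  obtain ⟨a, -, ha⟩ := H s (fun k => D ⊓ N k) hsA
    (fun k => .of_open n (le_inf (hVD 0) (hUN k)) (inf_le_right.trans (hNA k)))
    (fun i j hij => inf_le_inf_left _ (hN hij))
    (fun k => by
      have : s (k + 1) - s k = x k := by simp [s, Finset.sum_range_succ]
      rw [this]
      exact ⟨hVD (k + 1) (hxV k), hx k⟩)
  -- Membership in the increasing union `D` places `a` in some `V m`. Then `a - s m ∈ V m ⊓ N m ≤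
  -- V₀`, which forces `x m` into `N (m + 1)`, against independence.
  have haD : a ∈ D := by simpa [s] using (ha 0).1
  obtain ⟨m, hm⟩ := (Submodule.mem_iSup_of_directed V hVmono.directed_le).1 haD
  have h1 : a - s m - x m ∈ N (m + 1) := by
    have := (ha (m + 1)).2
    rwa [show s (m + 1) = s m + x m from Finset.sum_range_succ _ _, ← sub_sub] at this
  have h2 : a - s m ∈ V₀ := hVN m _ ((V m).sub_mem hm (hs m)) (ha m).2
  have h3 : x m ∈ N (m + 1) := by
    simpa using (N (m + 1)).sub_mem (hUN (m + 1) h2) h1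
  exact hxU m (by simpa using hind m 1 (by simpa using h3))

/-- A maximal filter of cosets contains a coset of each basic open submodule. -/
theorem exists_open_coset_mem (H : SeqCCompact A U) (hF : Maximal (CosetFilter A U) F) (n : ℕ) :
    ∃ a, coset a (U n ⊓ A) ∈ F := by
  by_contra hno
  let T := {N : Submodule (unitBallSubring K) E // U n ⊓ A ≤ N ∧ N ≤ A ∧ ∃ a, coset a N ∈ F}
  have step : ∀ N : T, ∃ (N' : T) (x : E), N'.1 ≤ N.1 ∧ x ∈ N.1 ∧ x ∉ U n ⊓ A ∧
      ∀ c : unitBallSubring K, c • x ∈ N'.1 → c • x ∈ U n ⊓ A := by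
    rintro ⟨N, hUN, hNA, a, ha⟩
    have hlt : ¬ N ≤ U n ⊓ A := fun h => hno ⟨a, le_antisymm hUN h ▸ ha⟩
    obtain ⟨x, hxN, hxU⟩ := SetLike.not_le_iff_exists.1 hlt
    obtain ⟨N', hUN', hN'N, hx, huni⟩ := exists_uniform_quot hUN x
    have hb := exists_coset_mem_of_uniserial H hF hUN' hN'N hNA
      (huni.uniserial H hUN' hN'N hNA) ha
    exact ⟨⟨N', hUN', hN'N.trans hNA, hb⟩, x, hN'N, hxN, hxU, hx⟩
  choose f x hfle hx hxU hind using step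
  have hA0 : coset 0 A = (A : Set E) := by ext; simp [mem_coset]
  let N : ℕ → T := fun k =>
    k.rec ⟨A, inf_le_right, le_rfl, 0, hA0 ▸ hF.1.self_mem⟩ fun _ M => f M
  exact not_exists_independent_seq H n (fun k => (N k).1) (fun k => x (N k))
    (antitone_nat_of_succ_le fun k => hfle (N k)) (fun k => (N k).2.2.1) (fun k => (N k).2.1)
    (fun k => hx (N k)) (fun k => hxU (N k)) (fun k => hind (N k))

/-- Sequential c-compactness implies c-compactness. -/
theorem SeqCCompact.nonempty_sInter (H : SeqCCompact A U)
    (hF : CosetFilter A U F) : (⋂₀ F).Nonempty := by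
  obtain ⟨G, hFG, hG⟩ := hF.exists_maximal
  choose a ha using exists_open_coset_mem H hG
  obtain ⟨b, hb, -⟩ := coset_iInf_mem H hG (N := fun n => U n ⊓ A)
    (fun n => .of_open n le_rfl inf_le_right) ha
  have hbA : b ∈ A := (hG.1.coset _ (ha 0)).subset (hb 0)
  refine ⟨b, fun C hC => ?_⟩
  have hmeet : ∀ n, ∃ y ∈ C, b - y ∈ U n := fun n => by
    obtain ⟨y, hyC, hy⟩ := hG.1.nonempty (hG.1.inter_mem _ (hFG hC) _ (ha n))
    refine ⟨y, hyC, ?_⟩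
    simpa using (U n).sub_mem (hb n).1 hy.1
  obtain ⟨x, hx, N, hN, rfl⟩ := hF.coset C hC
  refine hN.mem _ (A.sub_mem hbA hx) fun n => ?_
  obtain ⟨y, hy, hby⟩ := hmeet n
  exact ⟨y - x, hy, by simpa using hby⟩

end NonarchCompact

/-! ### Seminorms and convex functions. -/

namespace NonarchCompact

open Topology

variable {K : Type*} [NontriviallyNormedField K] {E : Type*} [AddCommGroup E] [Module K E]

theorem isNonarchimedean_finset_sup {ι : Type*} (p : ι → Seminorm K E)
    (hp : ∀ i, IsNonarchimedean (p i)) (s : Finset ι) : IsNonarchimedean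
      (s.sup p : Seminorm K E) := by
  classical
  induction s using Finset.induction_on with
  | empty => intro x y; simp
  | insert i s _ ih =>
    intro x y
    rw [Finset.sup_insert]
    simp only [Seminorm.sup_apply]
    exact max_le ((hp i x y).trans (max_le_max (le_max_left _ _) (le_max_left _ _)))
      ((ih x y).trans (max_le_max (le_max_right _ _) (le_max_right _ _)))

/-- The coefficients `1, c, -c` sum to `1` and have norm one, so no value is rescaled; this matters
when `r < 0`. -/
theorem NonarchConvexFun.le_of_unit {φ : E → ℝ} (hφ : NonarchConvexFun K φ) {r : ℝ} {u v w : E}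
    (hu : φ u ≤ r) (hv : φ v ≤ r) (hw : φ w ≤ r) {c : K} (hc : ‖c‖ = 1) :
    φ (u + c • (v - w)) ≤ r := by
  have h := hφ 2 ![u, v, w] ![1, c, -c] (fun i => by fin_cases i <;> simp [hc])
    (by simp [Fin.sum_univ_three])
  have heq : ∑ i, (![1, c, -c] : Fin 3 → K) i • (![u, v, w] : Fin 3 → E) i =
      u + c • (v - w) := by
    simp [Fin.sum_univ_three, sub_eq_add_neg, add_assoc]
  rw [heq] at h
  refine h.trans (Finset.sup'_le _ _ fun i _ => ?_)
  fin_cases i <;> simp [hc, hu, hv, hw]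

variable [IsUltrametricDist K]

/-- An absolutely convex set as a module over the closed unit ball. -/
def toSubmodule {B : Set E} (hB : NonarchAbsConvex K B) : Submodule (unitBallSubring K) E where
  carrier := B
  add_mem' {x y} hx hy := hB.add_mem x hx y hy
  zero_mem' := hB.zero_mem
  smul_mem' c x hx := hB.smul_mem c c.2 x hx

/-- The open ball of a non-archimedean seminorm as a module over the closed unit ball. -/
def seminormBall (p : Seminorm K E) (hp : IsNonarchimedean p) {r : ℝ} (hr : 0 < r) :
    Submodule (unitBallSubring K) E where
  carrier := p.ball 0 r
  add_mem' {x y} hx hy := by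
    rw [Seminorm.mem_ball_zero] at *
    exact (hp x y).trans_lt (max_lt hx hy)
  zero_mem' := by simpa using hr
  smul_mem' c x hx := by
    rw [Seminorm.mem_ball_zero] at *
    change p ((c : K) • x) < r
    rw [map_smul_eq_mul]
    exact (mul_le_of_le_one_left (apply_nonneg p x) c.2).trans_lt hx

/-! ### The escape function of a decreasing sequence. -/

section Escape

variable {X : Type*}

/-- The convex function measuring how long a point stays in a decreasing sequence of sets. -/
noncomputable def escape (V : ℕ → Set X) (y : X) : ℝ :=
  ∑' n, (V n)ᶜ.indicator (fun _ => (1 / 2 : ℝ) ^ n) y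

theorem indicator_le (V : ℕ → Set X) (n : ℕ) (y : X) :
    (V n)ᶜ.indicator (fun _ => (1 / 2 : ℝ) ^ n) y ≤ (1 / 2) ^ n :=
  Set.indicator_le_self' (fun _ _ => by positivity) y

theorem indicator_nonneg (V : ℕ → Set X) (n : ℕ) (y : X) :
    0 ≤ (V n)ᶜ.indicator (fun _ => (1 / 2 : ℝ) ^ n) y :=
  Set.indicator_nonneg (fun _ _ => by positivity) y

theorem summable_indicator (V : ℕ → Set X) (y : X) :
    Summable fun n => (V n)ᶜ.indicator (fun _ => (1 / 2 : ℝ) ^ n) y :=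
  .of_nonneg_of_le (fun n => indicator_nonneg V n y) (fun n => indicator_le V n y)
    summable_geometric_two

theorem escape_le_two (V : ℕ → Set X) (y : X) : escape V y ≤ 2 :=
  ((summable_indicator V y).tsum_le_tsum (fun n => indicator_le V n y)
    summable_geometric_two).trans_eq tsum_geometric_two

theorem escape_le_escape {V : ℕ → Set X} {y z : X} (h : ∀ n, z ∈ V n → y ∈ V n) :
    escape V y ≤ escape V z := by
  refine (summable_indicator V y).tsum_le_tsum (fun n => ?_) (summable_indicator V z)
  by_cases hz : z ∈ V n
  · simp [hz, h n hz]
  · exact (indicator_le V n y).trans_eq (by simp [hz])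

/-- Up to `n` the terms of `y` vanish; from `n` on those of `z` are full. -/
theorem escape_lt_escape {V : ℕ → Set X} (hV : Antitone V) {y z : X} {n : ℕ} (hy : y ∈ V n)
    (hz : z ∉ V n) : escape V y < escape V z := by
  refine Summable.tsum_lt_tsum (i := n) (fun m => ?_) ?_ (summable_indicator V y)
    (summable_indicator V z)
  · rcases le_total m n with h | h
    · simpa [hV h hy] using indicator_nonneg V m z
    · have : z ∉ V m := fun hm => hz (hV h hm)
      exact (indicator_le V m y).trans_eq (by simp [this])
  · simp [hy, hz]

theorem continuous_escape [TopologicalSpace X] {V : ℕ → Set X}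
    (hV : ∀ n, IsClopen (V n)) : Continuous (escape V) := by
  refine continuous_tsum (fun n => ?_) summable_geometric_two fun n y => ?_
  · exact (continuous_const (y := (1 / 2 : ℝ) ^ n)).indicator fun x hx => by
      simp [(hV n).compl.frontier_eq] at hx
  · rw [Real.norm_of_nonneg (indicator_nonneg V n y)]
    exact indicator_le V n y

end Escape

theorem sum_smul_mem_coset {x : E} {N : Submodule (unitBallSubring K) E} {m : ℕ}
    {y : Fin m → E} {c : Fin m → K} (hc : ∀ i, ‖c i‖ ≤ 1) (hsum : ∑ i, c i = 1)
    (hy : ∀ i, y i ∈ coset x N) : ∑ i, c i • y i ∈ coset x N := by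
  have h : ∑ i, c i • y i - x = ∑ i, c i • (y i - x) := by
    simp only [smul_sub, Finset.sum_sub_distrib, ← Finset.sum_smul, hsum, one_smul]
  rw [mem_coset, h]
  exact N.sum_mem fun i _ => N.smul_mem (⟨c i, hc i⟩ : unitBallSubring K) (hy i)

/-- Each `V n` containing the point of largest escape contains all the points, hence their
combination. Subtracting the total mass `2` makes the values nonpositive, so factors `‖c i‖ ≤ 1`
only increase them. -/
theorem convex_escape_sub_two {x : ℕ → E} {N : ℕ → Submodule (unitBallSubring K) E}
    (hV : Antitone fun n => coset (x n) (N n)) :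
    NonarchConvexFun K fun y => escape (fun n => coset (x n) (N n)) y - 2 := by
  intro m y c hc hsum
  set V := fun n => coset (x n) (N n) with hVdef
  obtain ⟨i, -, hi⟩ := Finset.exists_max_image Finset.univ (fun i => escape V (y i))
    Finset.univ_nonempty
  have hle : escape V (∑ j, c j • y j) ≤ escape V (y i) := by
    refine escape_le_escape fun n hin => sum_smul_mem_coset hc hsum fun j => ?_
    by_contra hj
    exact (hi j (Finset.mem_univ j)).not_gt (escape_lt_escape hV hin hj)
  have h2 := escape_le_two V (y i)
  calc escape V (∑ j, c j • y j) - 2 ≤ escape V (y i) - 2 := by linarith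
    _ ≤ ‖c i‖ * (escape V (y i) - 2) := by nlinarith [hc i]
    _ ≤ _ := Finset.le_sup' (fun j => ‖c j‖ * (escape V (y j) - 2)) (Finset.mem_univ i)

theorem NonarchConvexFun.le_of_norm_le_one {φ : E → ℝ} (hφ : NonarchConvexFun K φ) {r : ℝ}
    {u v w : E} (hu : φ u ≤ r) (hv : φ v ≤ r) (hw : φ w ≤ r) {c : K} (hc : ‖c‖ ≤ 1) :
    φ (u + c • (v - w)) ≤ r := by
  rcases hc.eq_or_lt with hc | hc
  · exact NonarchConvexFun.le_of_unit hφ hu hv hw hc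
  -- Writing `c = (1 + c) - 1` reduces to two steps with unit coefficients.
  · have hc1 : ‖1 + c‖ = 1 := by
      rw [IsUltrametricDist.norm_add_eq_max_of_norm_ne_norm (by simpa using hc.ne')]
      simpa using hc.le
    have h := NonarchConvexFun.le_of_unit hφ
      (NonarchConvexFun.le_of_unit hφ hu hv hw hc1) hv hw (c := (-1 : K)) (by simp)
    convert h using 2
    module

theorem nonarchConvex_sublevel {φ : E → ℝ} (hφ : NonarchConvexFun K φ) {A : Set E}
    (hA : NonarchAbsConvex K A) {a : E} (ha : a ∈ A) :
    NonarchConvex K {y ∈ A | φ y ≤ φ a} := by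
  refine ⟨a, {b | b ∈ A ∧ φ (a + b) ≤ φ a}, ⟨⟨hA.zero_mem, by simp⟩, ?_, ?_⟩, ?_⟩
  · rintro x ⟨hx, hxφ⟩ y ⟨hy, hyφ⟩
    refine ⟨hA.add_mem x hx y hy, ?_⟩
    have := NonarchConvexFun.le_of_unit hφ hxφ hyφ (le_refl (φ a)) (c := (1 : K)) (by simp)
    simpa [add_assoc] using this
  · rintro c hc x ⟨hx, hxφ⟩
    refine ⟨hA.smul_mem c hc x hx, ?_⟩
    simpa using NonarchConvexFun.le_of_norm_le_one hφ (le_refl (φ a)) hxφ (le_refl (φ a)) hc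
  · ext y
    simp only [Set.mem_image, Set.mem_ofPred_eq]
    constructor
    · rintro ⟨hy, hyφ⟩
      refine ⟨y - a, ⟨?_, by simpa using hyφ⟩, by abel⟩
      have := hA.add_mem y hy _ (hA.smul_mem (-1) (by simp) a ha)
      simpa [sub_eq_add_neg] using this
    · rintro ⟨b, ⟨hb, hbφ⟩, rfl⟩
      exact ⟨hA.add_mem a ha b hb, hbφ⟩

/-! ### The two implications. -/

variable [TopologicalSpace E]

theorem exists_antitone_basis [FirstCountableTopology E] (hE : NonarchLocallyConvex K E) :
    ∃ U : ℕ → Submodule (unitBallSubring K) E,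
      (𝓝 (0 : E)).HasAntitoneBasis fun n => (U n : Set E) := by
  obtain ⟨P, -, hP, hW⟩ := hE
  obtain ⟨s, hs, hbasis⟩ := hW.hasBasis_zero_ball.exists_antitone_subbasis
  exact ⟨fun n => seminormBall _
    (isNonarchimedean_finset_sup (fun p : P => (p : Seminorm K E)) (fun p => hP p p.2) (s n).1)
    (hs n), hbasis⟩

theorem cfCompact_of_cCompact {A : Set E} (hA : NonarchAbsConvex K A) (h : CCompact K A) :
    CfCompact K A := by
  intro φ hcont hφ
  obtain ⟨a, haA, ha⟩ := h ((fun x => {y ∈ A | φ y ≤ φ x}) '' A)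
    (by
      rintro _ ⟨x, hx, rfl⟩
      refine ⟨Set.sep_subset _ _, nonarchConvex_sublevel hφ hA hx, {y | φ y ≤ φ x},
        isClosed_le hcont continuous_const, ?_⟩
      ext y
      exact and_comm)
    (by
      intro 𝒟 h𝒟 hfin
      obtain ⟨s, hsA, hsfin, rfl⟩ := Set.exists_subset_image_finite_and.1 ⟨𝒟, h𝒟, hfin, rfl⟩
      rcases s.eq_empty_or_nonempty with rfl | hne
      · exact ⟨0, by simpa using hA.zero_mem⟩
      · obtain ⟨x, hxs, hx⟩ := Set.exists_min_image s φ hsfin hne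
        refine ⟨x, hsA hxs, ?_⟩
        rintro _ ⟨y, hy, rfl⟩
        exact ⟨hsA hxs, hx y hy⟩)
  exact ⟨a, haA, fun b hb => (ha _ ⟨b, hb, rfl⟩).2⟩

variable [IsTopologicalAddGroup E]

theorem isClopen_coset {N : Submodule (unitBallSubring K) E} (hN : (N : Set E) ∈ 𝓝 0) (x : E) :
    IsClopen (coset x N) := by
  have hopen : IsOpen (N : Set E) := N.toAddSubgroup.isOpen_of_mem_nhds hN
  have hclosed : IsClosed (N : Set E) := N.toAddSubgroup.isClosed_of_isOpen hopen
  have hcont : Continuous fun y : E => y - x := continuous_id.sub continuous_const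
  exact ⟨hclosed.preimage hcont, hopen.preimage hcont⟩

theorem seqCCompact_of_cfCompact {A : Submodule (unitBallSubring K) E}
    {U : ℕ → Submodule (unitBallSubring K) E}
    (hU : (𝓝 (0 : E)).HasAntitoneBasis fun n => (U n : Set E)) (hA : CfCompact K (A : Set E)) :
    SeqCCompact A U := by
  intro x N hx hN hNanti hxN
  have hxmn : ∀ m n, m ≤ n → x n - x m ∈ N m := by
    intro m n hmn
    induction n, hmn using Nat.le_induction with
    | base => simp
    | succ n hmn ih => simpa using (N m).add_mem (hNanti hmn (hxN n)) ih
  set V := fun n => coset (x n) (N n ⊔ U n) with hVdef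
  have hV : Antitone V := antitone_nat_of_succ_le fun n y hy => by
    have hle : N (n + 1) ⊔ U (n + 1) ≤ N n ⊔ U n :=
      sup_le_sup (hNanti n.le_succ) (hU.antitone n.le_succ)
    change y - x n ∈ N n ⊔ U n
    rw [← sub_add_sub_cancel y (x (n + 1)) (x n)]
    exact Submodule.add_mem _ (hle hy) (Submodule.mem_sup_left (hxN n))
  have hclopen : ∀ n, IsClopen (V n) := fun n => isClopen_coset
    (Filter.mem_of_superset (hU.mem n) (SetLike.coe_subset_coe.2
      (le_sup_right : U n ≤ N n ⊔ U n))) _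
  obtain ⟨a, haA, ha⟩ := hA _ ((continuous_escape hclopen).sub continuous_const)
    (convex_escape_sub_two hV)
  -- Were `a ∉ V n`, the point `x n ∈ A` would have a strictly smaller value.
  have haV : ∀ n, a ∈ V n := fun n => by
    by_contra han
    have hlt := escape_lt_escape hV (self_mem_coset (x n) (N n ⊔ U n)) han
    exact (sub_lt_sub_right hlt 2).not_ge (ha (x n) (hx n))
  refine ⟨a, haA, fun m => (hN m).mem _ (A.sub_mem haA (hx m)) fun n => ?_⟩
  -- The index `max m n` puts the coset part in `N m` and the error in `U n` at once.
  obtain ⟨y, hy, u, hu, hyu⟩ := Submodule.mem_sup.1 (haV (max m n))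
  refine ⟨y + (x (max m n) - x m),
    (N m).add_mem (hNanti (le_max_left m n) hy) (hxmn _ _ (le_max_left m n)), ?_⟩
  have : a - x m - (y + (x (max m n) - x m)) = u := by
    rw [← sub_eq_iff_eq_add'.2 hyu.symm]
    abel
  rw [this]
  exact hU.antitone (le_max_right m n) hu

theorem closedCoset_of_nonarchConvex {A : Submodule (unitBallSubring K) E}
    {U : ℕ → Submodule (unitBallSubring K) E}
    (hU : (𝓝 (0 : E)).HasAntitoneBasis fun n => (U n : Set E)) {C F : Set E} (hCA : C ⊆ A)
    (hC : NonarchConvex K C) (hF : IsClosed F) (hCF : C = F ∩ A) : ClosedCoset A U C := by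
  obtain ⟨x, B, hB, hCB⟩ := hC
  have hmem : ∀ y, y ∈ C ↔ y - x ∈ B := fun y => by
    rw [hCB, Set.mem_image]
    exact ⟨by rintro ⟨b, hb, rfl⟩; simpa using hb, fun h => ⟨_, h, by abel⟩⟩
  have hxA : x ∈ A := hCA ((hmem x).2 (by simpa using hB.zero_mem))
  have hBA : ∀ b ∈ B, b ∈ A := fun b hb => by
    have : x + b ∈ A := hCA ((hmem _).2 (by simpa using hb))
    simpa using A.sub_mem this hxA
  refine ⟨x, hxA, toSubmodule hB, ⟨hBA, fun a ha h => ?_⟩, Set.ext hmem⟩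
  have hxa : x + a ∈ C := by
    rw [hCF]
    refine ⟨?_, A.add_mem hxA ha⟩
    rw [← hF.closure_eq, mem_closure_iff_nhds]
    intro t ht
    have ht0 : (fun u => x + a - u) ⁻¹' t ∈ 𝓝 (0 : E) := by
      refine (continuous_const.sub continuous_id).continuousAt.preimage_mem_nhds ?_
      simpa using ht
    obtain ⟨n, hn⟩ := hU.mem_iff.1 ht0
    obtain ⟨y, hy, hay⟩ := h n
    have hyC : x + y ∈ C := (hmem _).2 (by simpa using show y ∈ B from hy)
    rw [hCF] at hyC
    refine ⟨x + y, ?_, hyC.1⟩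
    simpa [show x + a - (a - y) = x + y by abel] using hn hay
  have hab := (hmem _).1 hxa
  rwa [add_sub_cancel_left] at hab

theorem SeqCCompact.cCompact {A : Submodule (unitBallSubring K) E}
    {U : ℕ → Submodule (unitBallSubring K) E}
    (hU : (𝓝 (0 : E)).HasAntitoneBasis fun n => (U n : Set E)) (H : SeqCCompact A U) :
    CCompact K (A : Set E) := by
  intro 𝒞 h𝒞 hfip
  have hcl : ∀ C ∈ 𝒞, ClosedCoset A U C := fun C hC => by
    obtain ⟨hCA, hconv, F, hF, hCF⟩ := h𝒞 C hC
    exact closedCoset_of_nonarchConvex hU hCA hconv hF hCF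
  -- Finite intersections are again closed cosets because the finite intersection property keeps
  -- them nonempty.
  have hfilter : CosetFilter A U
      {C | ∃ 𝒟 : Set (Set E), 𝒟 ⊆ 𝒞 ∧ 𝒟.Finite ∧ C = (A : Set E) ∩ ⋂₀ 𝒟} := by
    refine ⟨?_, ⟨∅, by simp⟩, ?_⟩
    · rintro C ⟨𝒟, hsub, hfin, rfl⟩
      induction 𝒟, hfin using Set.Finite.induction_on with
      | empty => simpa using ClosedCoset.self
      | @insert D 𝒟 hD hfin ih =>
        rw [Set.insert_subset_iff] at hsub
        have hne := hfip (insert D 𝒟) (Set.insert_subset hsub.1 hsub.2) (hfin.insert D)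
        rw [Set.sInter_insert, Set.inter_left_comm] at hne ⊢
        exact (hcl D hsub.1).inter (ih hsub.2) hne
    · rintro _ ⟨𝒟, hsub, hfin, rfl⟩ _ ⟨𝒟', hsub', hfin', rfl⟩
      refine ⟨𝒟 ∪ 𝒟', Set.union_subset hsub hsub', hfin.union hfin', ?_⟩
      rw [Set.sInter_union]
      exact (Set.inter_inter_distrib_left _ _ _).symm
  obtain ⟨a, ha⟩ := H.nonempty_sInter hfilter
  have haA : a ∈ (A : Set E) := ha _ ⟨∅, by simp⟩
  refine ⟨a, haA, fun C hC => ?_⟩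
  have : a ∈ (A : Set E) ∩ ⋂₀ {C} := ha _ ⟨{C}, by simpa using hC, Set.finite_singleton C, rfl⟩
  simpa using this.2

end NonarchCompact

theorem mainTheorem2 {K : Type*} [NontriviallyNormedField K] [IsUltrametricDist K]
    [CompleteSpace K] {E : Type*} [AddCommGroup E] [Module K E] [TopologicalSpace E]
    [IsTopologicalAddGroup E] [ContinuousSMul K E] [TopologicalSpace.MetrizableSpace E]
    (hE : NonarchLocallyConvex K E) (A : Set E) (hA : NonarchAbsConvex K A) :
    CfCompact K A ↔ CCompact K A := by
  obtain ⟨U, hU⟩ := NonarchCompact.exists_antitone_basis hE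
  exact ⟨fun h => NonarchCompact.SeqCCompact.cCompact (A := NonarchCompact.toSubmodule hA) hU
    (NonarchCompact.seqCCompact_of_cfCompact hU h), NonarchCompact.cfCompact_of_cCompact hA⟩
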